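/- **Proposition.** Let $\mathcal A$ be a $C^*$-weak Hopf algebra, i.e. a finite-dimensional $C^*$-algebra with a coassociative, multiplicative, $*$-preserving coproduct $\Delta$ with counit $\epsilon$ such that $\epsilon(xyz)=\sum\epsilon(xy_{(1)})\epsilon(y_{(2)}z)$ and $(\Delta\otimes\mathrm{id})\Delta(1)=(\Delta(1)\otimes1)(1\otimes\Delta(1))$, and with a bijective linear antipode $S$ such that $\sum S(x_{(1)})x_{(2)}=\sum 1_{(1)}\epsilon(x1_{(2)})$ and $\sum x_{(1)}S(x_{(2)})=\sum\epsilon(1_{(1)}x)1_{(2)}$. Equip the dual $\mathcal A^*$ with the product $(fg)(x)=(f\otimes g)(\Delta(x))$, the unit $\epsilon$ and the involution $f^*(x)=\overline{f(S(x)^*)}$. For each equivalence class $a\in\mathrm{Irr}(\mathcal A^*)$ of irreducible $*$-representations $\psi_a$ of $\mathcal A^*$, let $\tau_a\in\mathcal A$ be the cocentral element determined by $f(\tau_a)=\mathrm{Tr}\,\psi_a(f)$ for all $f\in\mathcal A^*$, and let $\mathcal T=\mathrm{span}\{\tau_a\}$. Suppose that $\tau_I=\sum_a e_a\tau_a$ ($e_a\in\mathbb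 C$) is the identity element of $\mathcal T$ and that $u=\sum_a u_a\tau_a$ ($u_a\in\mathbb C$) satisfies $u^*u=uu^*=\tau_I$. Let $\phi:\mathcal A\to\mathcal M(\mathbb C^d)$ be an injective (unital, $*$-preserving) representation, and for $N\ge1$ put $\mathrm{MPO}_\phi(x)=\phi^{\otimes N}(\Delta^{N-1}(x))$ and $$U_N=\mathbb 1^{\otimes N}+\sum_{a\in\mathrm{Irr}(\mathcal A^*)}(u_a-e_a)\,\mathrm{MPO}_\phi(\tau_a).$$ Then there are finitely many tensors $A_k=(A_k^{ij})_{i,j=1}^d$ with $A_k^{ij}\in\mathcal M(\mathbb C^{D_k})$ and matrices $b_k\in\mathcal M(\mathbb C^{D_k})$, none of them depending on $N$, such that, with $A^{ij}=\bigoplus_kA_k^{ij}$ and $b=\bigoplus_kb_k$: 1. for every $N\ge1$, $U_N$ is unitary and $\langle i_1\dots i_N|U_N|j_1\dots j_N\rangle=\mathrm{Tr}[\,b\,A^{i_1j_1}\cdots A^{i_Nj_N}]$; that is, $(A,b)$ defines a matrix-product unitary (MPU); 2. each $A_k$ is injective: $X\mapsto\sum_{ij}\mathrm{Tr}[XA_k^{ij}]\,|i\rangle\langle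 j|$ is an injective map on $\mathcal M(\mathbb C^{D_k})$; 3. the $A_k$ are independent: for all sufficiently large $N$ the $N$-site matrix-product operators with entries $\mathrm{Tr}[A_k^{i_1j_1}\cdots A_k^{i_Nj_N}]$ are linearly independent; 4. every $b_k$ is invertible; 5. with the open-boundary bulk tensor $\tilde A^{ij}=\bigoplus_k\mathbb 1_{D_k}\otimes A_k^{ij}$ of bond dimension $D=\sum_kD_k^2$ and the boundary vectors $\langle l|=\bigoplus_k\sum_{\alpha\beta}(b_k)_{\alpha\beta}\langle\alpha,\beta|$, $|r\rangle=\bigoplus_k\sum_\alpha|\alpha,\alpha\rangle$, one has $\langle i_1\dots i_N|U_N|j_1\dots j_N\rangle=\langle l|\tilde A^{i_1j_1}\cdots\tilde A^{i_Nj_N}|r\rangle$ for every $N\ge1$, and this uniform-bulk MPU satisfies the following rank condition (Assumption 1) after blocking: for every $q\ge2$ the linear maps $v\mapsto(\langle l|\tilde A^{i_1j_1}\cdots\tilde A^{i_qj_q}|v\rangle)_{i,j}$ and $v\mapsto(\langle v|\tilde A^{i_1j_1}\cdots\tilde A^{i_qj_q}|r\rangle)_{i,j}$ on the bond space $\mathbb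 C^D$ both have rank $D$. -/

import Mathlib

open scoped TensorProduct Matrix

noncomputable section

/-! ### C*-weak Hopf algebras -/

/-- A C*-weak Hopf algebra: a finite-dimensional C*-algebra with a coassociative counital coproduct
`Δ = comul`, `ε = counit` (Mathlib's `Coalgebra`), a weak multiplicativity of unit and counit, and
an antipode. No further antipode identity is imposed, so that the class is as large as possible. -/
class CStarWeakHopfAlgebra (A : Type*) [CStarAlgebra A] [FiniteDimensional ℂ A]
    extends Coalgebra ℂ A where
  /-- `Δ(xy) = Δ(x)Δ(y)` -/
  comul_mul : ∀ x y : A, comul (x * y) = comul x * comul y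
  /-- `Δ(x*) = Δ(x)*` -/
  comul_star : ∀ x : A, comul (star x) = star (comul x)
  /-- `ε(xyz) = ∑ ε(x y₁) ε(y₂ z)` -/
  counit_mul_mul : ∀ x y z : A, counit (x * y * z) =
    LinearMap.mul' ℂ ℂ (TensorProduct.map (counit ∘ₗ LinearMap.mulLeft ℂ x)
      (counit ∘ₗ LinearMap.mulRight ℂ z) (comul y))
  /-- `(Δ ⊗ id)(Δ(1)) = (Δ(1) ⊗ 1)(1 ⊗ Δ(1))` -/
  comul_comul_one : comul.rTensor A (comul (1 : A)) =
    (comul (1 : A) ⊗ₜ[ℂ] (1 : A)) *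
      (TensorProduct.assoc ℂ A A A).symm ((1 : A) ⊗ₜ[ℂ] comul (1 : A))
  /-- The antipode, a linear bijection. -/
  antipode : A ≃ₗ[ℂ] A
  /-- `∑ S(x₁) x₂ = ∑ 1₁ ε(x 1₂)` -/
  antipode_mul_id : ∀ x : A,
    LinearMap.mul' ℂ A (TensorProduct.map antipode.toLinearMap LinearMap.id (comul x)) =
      TensorProduct.rid ℂ A (TensorProduct.map LinearMap.id
        (counit ∘ₗ LinearMap.mulLeft ℂ x) (comul (1 : A)))
  /-- `∑ x₁ S(x₂) = ∑ ε(1₁ x) 1₂` -/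
  id_mul_antipode : ∀ x : A,
    LinearMap.mul' ℂ A (TensorProduct.map LinearMap.id antipode.toLinearMap (comul x)) =
      TensorProduct.lid ℂ A (TensorProduct.map (counit ∘ₗ LinearMap.mulRight ℂ x)
        LinearMap.id (comul (1 : A)))

namespace CStarWeakHopfAlgebra

variable (A : Type*) [CStarAlgebra A] [FiniteDimensional ℂ A] [CStarWeakHopfAlgebra A]

variable {A} in
/-- The product of the dual algebra: `⟨fg, x⟩ = ⟨f ⊗ g, Δ(x)⟩`. Its unit is the counit `ε`. -/
def dualMul (f g : Module.Dual ℂ A) : Module.Dual ℂ A :=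
  LinearMap.mul' ℂ ℂ ∘ₗ TensorProduct.map f g ∘ₗ Coalgebra.comul

variable {A} in
/-- The involution of the dual algebra: `⟨f*, x⟩` is the complex conjugate of `⟨f, S(x)*⟩`. -/
def dualStar (f : Module.Dual ℂ A) : Module.Dual ℂ A where
  toFun x := star (f (star (antipode x)))
  map_add' x y := by simp
  map_smul' c x := by simp

/-- An irreducible representation of the dual C*-algebra on `ℂ^dim`. -/
structure DualIrrep where
  /-- dimension of the representation -/
  dim : ℕ
  dim_pos : 0 < dim
  /-- the representation -/
  rep : Module.Dual ℂ A →ₗ[ℂ] Matrix (Fin dim) (Fin dim) ℂ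
  map_mul : ∀ f g, rep (dualMul f g) = rep f * rep g
  map_star : ∀ f, rep (dualStar f) = (rep f)ᴴ
  map_one : rep (Coalgebra.counit : A →ₗ[ℂ] ℂ) = 1
  irreducible : ∀ W : Submodule ℂ (Fin dim → ℂ),
    (∀ f, ∀ w ∈ W, rep f *ᵥ w ∈ W) → W = ⊥ ∨ W = ⊤

variable {A} in
/-- Equivalence of representations: an invertible intertwiner exists. -/
def DualIrrep.Equivalent (ψ₁ ψ₂ : DualIrrep A) : Prop :=
  ∃ (X : Matrix (Fin ψ₂.dim) (Fin ψ₁.dim) ℂ) (Y : Matrix (Fin ψ₁.dim) (Fin ψ₂.dim) ℂ),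
    X * Y = 1 ∧ Y * X = 1 ∧ ∀ f, X * ψ₁.rep f = ψ₂.rep f * X

instance DualIrrep.setoid : Setoid (DualIrrep A) where
  r := DualIrrep.Equivalent
  iseqv :=
    { refl := fun ψ => ⟨1, 1, by simp, by simp, by simp⟩
      symm := by
        rintro ψ₁ ψ₂ ⟨X, Y, hXY, hYX, h⟩
        refine ⟨Y, X, hYX, hXY, fun f => ?_⟩
        calc Y * ψ₂.rep f = Y * (ψ₂.rep f * X) * Y := by
              rw [Matrix.mul_assoc, Matrix.mul_assoc, hXY, Matrix.mul_one]
          _ = Y * X * ψ₁.rep f * Y := by rw [← h, Matrix.mul_assoc Y X]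
          _ = ψ₁.rep f * Y := by rw [hYX, Matrix.one_mul]
      trans := by
        rintro ψ₁ ψ₂ ψ₃ ⟨X, Y, hXY, hYX, h⟩ ⟨X', Y', hXY', hYX', h'⟩
        refine ⟨X' * X, Y * Y', ?_, ?_, fun f => ?_⟩
        · rw [Matrix.mul_assoc, ← Matrix.mul_assoc X, hXY, Matrix.one_mul, hXY']
        · rw [Matrix.mul_assoc, ← Matrix.mul_assoc Y', hYX', Matrix.one_mul, hYX]
        · rw [Matrix.mul_assoc, h, ← Matrix.mul_assoc, h', Matrix.mul_assoc] }

/-- `Irr(A*)`: equivalence classes of irreducible representations of the dual algebra. -/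
def Irr : Type _ := Quotient (DualIrrep.setoid A)

variable {A} in
/-- The character `f ↦ Tr ψ(f)`. -/
def DualIrrep.character (ψ : DualIrrep A) : Module.Dual ℂ (Module.Dual ℂ A) :=
  Matrix.traceLinearMap (Fin ψ.dim) ℂ ℂ ∘ₗ ψ.rep

variable {A} in
/-- The cocentral element `τ_a` of the class `a`: the element of `A` with
`f(τ_a) = Tr ψ_a(f)` for every `f` in the dual of `A`. -/
def cocentral (a : Irr A) : A :=
  Quotient.lift (fun ψ : DualIrrep A => (Module.evalEquiv ℂ A).symm ψ.character) (by
    rintro ψ₁ ψ₂ ⟨X, Y, hXY, hYX, h⟩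
    refine congrArg _ (LinearMap.ext fun f => ?_)
    change (ψ₁.rep f).trace = (ψ₂.rep f).trace
    calc (ψ₁.rep f).trace = (Y * (X * ψ₁.rep f)).trace := by
          rw [← Matrix.mul_assoc, hYX, Matrix.one_mul]
      _ = (X * Y * ψ₂.rep f).trace := by
          rw [h, Matrix.trace_mul_comm, Matrix.mul_assoc, Matrix.trace_mul_comm]
      _ = (ψ₂.rep f).trace := by rw [hXY, Matrix.one_mul]) a

variable {A} in
theorem apply_cocentral (ψ : DualIrrep A) (f : Module.Dual ℂ A) :
    f (cocentral (Quotient.mk (DualIrrep.setoid A) ψ)) = (ψ.rep f).trace :=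
  Module.apply_evalEquiv_symm_apply ℂ A f ψ.character

/-- The span `𝒯` of the cocentral elements. -/
def cocentralSpan : Submodule ℂ A := Submodule.span ℂ (Set.range (cocentral (A := A)))

variable {A} in
/-- The element `∑_a c_a τ_a`. The set `Irr A` is finite, so finitely supported families are
the same thing as all families. -/
def cocentralSum (c : Irr A →₀ ℂ) : A := c.sum fun a z => z • cocentral a

variable {A} in
/-- `t` is the identity element of `𝒯`. -/
def IsCocentralIdentity (t : A) : Prop :=
  t ∈ cocentralSpan A ∧ ∀ x ∈ cocentralSpan A, t * x = x ∧ x * t = x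

/-- The iterated coproduct `Δⁿ : A → A^{⊗(n+1)}`, with `Δ⁰ = id` and
`Δ^{n+1} = (Δⁿ ⊗ id) ∘ Δ`. -/
def iterComul : (n : ℕ) → A →ₗ[ℂ] TensorPower ℂ (n + 1) A
  | 0 => (PiTensorProduct.subsingletonEquiv (R := ℂ) (s := fun _ : Fin 1 => A) 0).symm.toLinearMap
  | n + 1 =>
      (TensorPower.mulEquiv (R := ℂ) (M := A) (n := n + 1) (m := 1)).toLinearMap ∘ₗ
        TensorProduct.map (iterComul n)
          (PiTensorProduct.subsingletonEquiv (R := ℂ)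
            (s := fun _ : Fin 1 => A) 0).symm.toLinearMap ∘ₗ
        Coalgebra.comul

end CStarWeakHopfAlgebra

/-! ### Matrix-product operators -/

/-- The tensor (Kronecker) product of `N` matrices on the `N`-site space, as a multilinear map:
`⟨i|M₁ ⊗ ⋯ ⊗ M_N|j⟩ = ∏ₖ ⟨iₖ|Mₖ|jₖ⟩`. -/
def kroneckerProd (κ : Type*) (N : ℕ) :
    MultilinearMap ℂ (fun _ : Fin N => Matrix κ κ ℂ) (Matrix (Fin N → κ) (Fin N → κ) ℂ) where
  toFun M := Matrix.of fun i j => ∏ k, M k (i k) (j k)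
  map_update_add' M k X Y := by
    ext i j
    exact ((MultilinearMap.mkPiAlgebra ℂ (Fin N) ℂ).compLinearMap fun k =>
      Matrix.entryLinearMap ℂ ℂ (i k) (j k)).map_update_add M k X Y
  map_update_smul' M k c X := by
    ext i j
    exact ((MultilinearMap.mkPiAlgebra ℂ (Fin N) ℂ).compLinearMap fun k =>
      Matrix.entryLinearMap ℂ ℂ (i k) (j k)).map_update_smul M k c X

/-- A tensor with physical index set `κ` and bond index set `β`: `T i j` is the matrix `T^{ij}` on
the bond space, `i` being the output and `j` the input physical index. -/
abbrev MPOTensor (κ β : Type*) := κ → κ → Matrix β β ℂ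

namespace MPOTensor

variable {κ β : Type*} [Fintype β] [DecidableEq β]

/-- The product `T^{i₁j₁} ⋯ T^{i_N j_N}`, that is, the tensor of `N` blocked sites. -/
def block (T : MPOTensor κ β) (N : ℕ) : MPOTensor (Fin N → κ) β :=
  fun i j => (List.ofFn fun k => T (i k) (j k)).prod

/-- The `N`-site operator with entries `Tr[b T^{i₁j₁} ⋯ T^{i_N j_N}]`. -/
def closedMPO (T : MPOTensor κ β) (b : Matrix β β ℂ) (N : ℕ) :
    Matrix (Fin N → κ) (Fin N → κ) ℂ :=
  Matrix.of fun i j => (b * T.block N i j).trace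

/-- The `N`-site operator with entries `⟨l| T^{i₁j₁} ⋯ T^{i_N j_N} |r⟩`. -/
def openMPO (T : MPOTensor κ β) (l r : β → ℂ) (N : ℕ) :
    Matrix (Fin N → κ) (Fin N → κ) ℂ :=
  Matrix.of fun i j => l ⬝ᵥ (T.block N i j *ᵥ r)

/-- The tensor `T` with boundary operator `b` defines a matrix-product unitary: the closed MPO is
unitary for every number `N ≥ 1` of sites. -/
def IsMPU [Fintype κ] [DecidableEq κ] (T : MPOTensor κ β) (b : Matrix β β ℂ) : Prop :=
  ∀ N : ℕ, 1 ≤ N → T.closedMPO b N ∈ Matrix.unitaryGroup (Fin N → κ) ℂ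

/-- The tensor `T` with boundary vectors `l`, `r` defines a uniform-bulk MPU. -/
def IsOpenMPU [Fintype κ] [DecidableEq κ] (T : MPOTensor κ β) (l r : β → ℂ) : Prop :=
  ∀ N : ℕ, 1 ≤ N → T.openMPO l r N ∈ Matrix.unitaryGroup (Fin N → κ) ℂ

/-- Injectivity of a tensor: `X ↦ ∑_{ij} Tr[X T^{ij}] |i⟩⟨j|` is an injective map. -/
def IsInjective (T : MPOTensor κ β) : Prop :=
  Function.Injective fun X : Matrix β β ℂ => (Matrix.of fun i j => (X * T i j).trace : Matrix κ κ ℂ)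

/-- Independence of a family of tensors: for all sufficiently large `N` the `N`-site operators with
periodic boundary that they generate are linearly independent. -/
def Independent {g : ℕ} {D : Fin g → ℕ} (T : ∀ k, MPOTensor κ (Fin (D k))) : Prop :=
  ∃ N₀ : ℕ, ∀ N ≥ N₀, LinearIndependent ℂ fun k => (T k).closedMPO 1 N

/-- The rank condition: the linear maps from the bond space to the physical
space of one site given by `v ↦ ⟨l| T^{ij} |v⟩` and `v ↦ ⟨v| T^{ij} |r⟩` have rank equal to
the bond dimension. -/
def RankCondition [Fintype κ] (T : MPOTensor κ β) (l r : β → ℂ) : Prop :=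
  (Matrix.of fun (p : κ × κ) (n : β) => (l ᵥ* T p.1 p.2) n).rank = Fintype.card β ∧
  (Matrix.of fun (p : κ × κ) (m : β) => (T p.1 p.2 *ᵥ r) m).rank = Fintype.card β

section Blocks

variable {g : ℕ} {D : Fin g → ℕ}

/-- The block-diagonal tensor `⨁ₖ T_k^{ij}`. -/
def directSum (T : ∀ k, MPOTensor κ (Fin (D k))) : MPOTensor κ (Σ k, Fin (D k)) :=
  fun i j => Matrix.blockDiagonal' fun k => T k i j

/-- The open-boundary bulk tensor `⨁ₖ 1 ⊗ T_k^{ij}` on `⨁ₖ ℂ^{D_k} ⊗ ℂ^{D_k}`. -/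
def openTensor (T : ∀ k, MPOTensor κ (Fin (D k))) :
    MPOTensor κ (Σ k, Fin (D k) × Fin (D k)) :=
  fun i j => Matrix.blockDiagonal' fun k =>
    Matrix.kroneckerMap (· * ·) (1 : Matrix (Fin (D k)) (Fin (D k)) ℂ) (T k i j)

/-- The left boundary vector `⟨l| = ⨁ₖ ∑_{αβ} (b_k)_{αβ} ⟨α,β|`. -/
def openLeft (b : ∀ k, Matrix (Fin (D k)) (Fin (D k)) ℂ) : (Σ k, Fin (D k) × Fin (D k)) → ℂ :=
  fun s => b s.1 s.2.1 s.2.2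

/-- The right boundary vector `|r⟩ = ⨁ₖ ∑_α |α,α⟩`. -/
def openRight (D : Fin g → ℕ) : (Σ k, Fin (D k) × Fin (D k)) → ℂ :=
  fun s => if s.2.1 = s.2.2 then 1 else 0

end Blocks

end MPOTensor

namespace CStarWeakHopfAlgebra

variable {A : Type*} [CStarAlgebra A] [FiniteDimensional ℂ A] [CStarWeakHopfAlgebra A]

/-- `MPO_φ(x) = φ^{⊗(n+1)} (Δⁿ(x))`, an operator on `n + 1` sites. -/
def mpo {d : ℕ} (φ : A →⋆ₐ[ℂ] Matrix (Fin d) (Fin d) ℂ) (n : ℕ) (x : A) :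
    Matrix (Fin (n + 1) → Fin d) (Fin (n + 1) → Fin d) ℂ :=
  PiTensorProduct.lift (kroneckerProd (Fin d) (n + 1))
    (PiTensorProduct.map (fun _ => (φ : A →ₐ[ℂ] Matrix (Fin d) (Fin d) ℂ).toLinearMap)
      (iterComul A n x))

/-- The operator `1^{⊗N} + ∑_a (u_a - e_a) MPO_φ(τ_a)` on `N = n + 1` sites. -/
def mpuOperator {d : ℕ} (φ : A →⋆ₐ[ℂ] Matrix (Fin d) (Fin d) ℂ) (e u : Irr A →₀ ℂ) (n : ℕ) :
    Matrix (Fin (n + 1) → Fin d) (Fin (n + 1) → Fin d) ℂ :=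
  1 + (u - e).sum fun a z => z • mpo φ n (cocentral a)

end CStarWeakHopfAlgebra

end

/-! Unitarity is algebraic. Since `Δ` is multiplicative and star-preserving, `mpo φ n` is a possibly
non-unital star-homomorphism. Thus `P = MPO(τ_I)` is a projection, `V = MPO(u)` satisfies `V P = V`
and `V V* = P`, and `1 + V - P` is unitary (`one_add_mpo_sub_mem_unitaryGroup`).

The blocks are the tensors `ψ_a(φ_pq)`, whose words are the values of `ψ_a` on convolution products
of matrix coefficients; tracing gives `MPO(τ_a)` (`mpo_cocentral`). Injectivity of `φ` makes the
coefficients span the dual, and the convolution unit `ε` makes products of any fixed positive length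
span it too (`eq_zero_of_coeffWord`). By Schur and Jacobson density, inequivalent irreducibles are
jointly surjective (`DualIrrep.exists_rep_eq`). So words of any positive length span the direct sum
of the full matrix algebras, which yields injectivity, independence and the rank condition.

The remaining summand `1^{⊗N}` has bond dimension one. If `Δ(1) = 1 ⊗ 1`, then evaluation at `1` is
itself an irreducible representation with cocentral element `1`, so the identity is absorbed into
the existing blocks (`exists_mpuOperator_eq_sum_mpo`). Otherwise, on two or more sites no nonzero
multiple of the identity has the form `MPO(x)` (`comul_one_of_mpo_eq_smul_one`), so the identity is
a genuinely new independent block. On one site this fails, as `φ(1) = 1`; hence the blocking length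
`q ≥ 2`. Discarding blocks with zero coefficient makes every `b_k` a nonzero scalar. -/

noncomputable section

/-! ### Density for finite families of simple modules -/

/-- For finitely many pairwise non-isomorphic simple modules over an algebra over an algebraically
closed field, every family of linear endomorphisms is the action of one element of the algebra. -/
theorem exists_smul_eq_of_pairwise_not_equiv {K R ι : Type*} [Field K] [IsAlgClosed K] [Ring R]
    [Algebra K R] [Fintype ι] [DecidableEq ι] (V : ι → Type*) [∀ k, AddCommGroup (V k)]
    [∀ k, Module K (V k)] [∀ k, Module R (V k)] [∀ k, IsScalarTower K R (V k)]
    [∀ k, FiniteDimensional K (V k)] [∀ k, IsSimpleModule R (V k)]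
    (hV : ∀ k l, k ≠ l → IsEmpty (V k ≃ₗ[R] V l)) (Y : ∀ k, V k →ₗ[K] V k) :
    ∃ r : R, ∀ k v, r • v = Y k v := by
  classical
  have hss : IsSemisimpleModule R (∀ k, V k) :=
    isSemisimpleModule_of_isSemisimpleModule_submodule'
      (p := fun k => LinearMap.range (LinearMap.single R V k))
      (fun k => .congr (LinearEquiv.ofInjective _ (Pi.single_injective k)).symm)
      (LinearMap.iSup_range_single R V)
  -- Schur's lemma: off-diagonal components of an endomorphism vanish, and diagonal ones are scalars
  -- because the field is algebraically closed.
  have hoff : ∀ (g : Module.End R (∀ k, V k)) (k l : ι), k ≠ l → ∀ v : V k,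
      g (Pi.single k v) l = 0 := by
    intro g k l hkl v
    rcases (LinearMap.proj l ∘ₗ g ∘ₗ LinearMap.single R V k).bijective_or_eq_zero with h | h
    · exact ((hV k l hkl).false (LinearEquiv.ofBijective _ h)).elim
    · exact LinearMap.congr_fun h v
  have hdiag : ∀ (g : Module.End R (∀ k, V k)) (k : ι), ∃ c : K, ∀ v : V k,
      g (Pi.single k v) k = c • v := by
    intro g k
    let gk : V k →ₗ[R] V k := LinearMap.proj k ∘ₗ g ∘ₗ LinearMap.single R V k
    have : Nontrivial (V k) := IsSimpleModule.nontrivial R (V k)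
    obtain ⟨c, hc⟩ := Module.End.exists_eigenvalue (gk.restrictScalars K : Module.End K (V k))
    obtain ⟨v, hv⟩ := hc.exists_hasEigenvector
    refine ⟨c, fun w => ?_⟩
    let ck : V k →ₗ[R] V k :=
      { toFun := fun w => c • w
        map_add' := smul_add c
        map_smul' := fun r w => by
          rw [RingHom.id_apply, ← algebraMap_smul R c (r • w), ← algebraMap_smul R c w, smul_smul,
            smul_smul, Algebra.commutes] }
    -- `gk - ck` kills an eigenvector, so it cannot be bijective.
    rcases (gk - ck).bijective_or_eq_zero with h | h
    · refine (hv.2 (h.1 ?_)).elim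
      rw [map_zero]
      exact sub_eq_zero.2 hv.apply_eq_smul
    · exact sub_eq_zero.1 (LinearMap.congr_fun h w)
  have hg : ∀ g : Module.End R (∀ k, V k), ∃ c : ι → K, ∀ m k, g m k = c k • m k := by
    intro g
    choose c hc using hdiag g
    refine ⟨c, fun m k => ?_⟩
    conv_lhs => rw [← Finset.univ_sum_single m]
    rw [map_sum, Finset.sum_apply, Finset.sum_eq_single k (fun l _ h => hoff g l k h _) (by simp),
      hc]
  -- The commutant acts by one scalar on each factor, so the blockwise map commutes with it and
  -- density applies.
  let F : Module.End (Module.End R (∀ k, V k)) (∀ k, V k) :=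
    { toFun := fun m k => Y k (m k)
      map_add' := fun m m' => by ext k; simp
      map_smul' := fun g m => by
        obtain ⟨c, hc⟩ := hg g
        ext k
        simp only [RingHom.id_apply, Module.End.smul_def, hc, map_smul] }
  -- Density gives agreement only on finite sets; bases of the factors are enough.
  let S : Finset (∀ k, V k) := Finset.univ.biUnion fun k =>
    Finset.univ.image fun i => Pi.single k (Module.finBasis K (V k) i)
  obtain ⟨r, hr⟩ := jacobson_density F S
  refine ⟨r, fun k v => ?_⟩
  let rk : V k →ₗ[K] V k :=
    { toFun := fun w => r • w
      map_add' := smul_add r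
      map_smul' := fun c w => by
        rw [RingHom.id_apply, ← algebraMap_smul R c (r • w), ← algebraMap_smul R c w, smul_smul,
            smul_smul, Algebra.commutes] }
  suffices h : rk = Y k from LinearMap.congr_fun h v
  refine (Module.finBasis K (V k)).ext fun i => ?_
  have h := congrFun (hr (Pi.single k (Module.finBasis K (V k) i)) (Finset.mem_biUnion.2
    ⟨k, Finset.mem_univ k, Finset.mem_image_of_mem _ (Finset.mem_univ i)⟩)) k
  simpa [F, rk] using h.symm

/-! ### Irreducible representations as simple modules over the convolution algebra -/

namespace CStarWeakHopfAlgebra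

variable {A : Type*} [CStarAlgebra A] [FiniteDimensional ℂ A] [CStarWeakHopfAlgebra A]

/-- The representation space of an irreducible representation, a module over the convolution
algebra of functionals. -/
def DualIrrep.Space (ψ : DualIrrep A) : Type := Fin ψ.dim → ℂ

namespace DualIrrep

variable (ψ : DualIrrep A)

instance : AddCommGroup ψ.Space := inferInstanceAs (AddCommGroup (Fin ψ.dim → ℂ))

instance : Module ℂ ψ.Space := inferInstanceAs (Module ℂ (Fin ψ.dim → ℂ))

instance : FiniteDimensional ℂ ψ.Space :=
  inferInstanceAs (FiniteDimensional ℂ (Fin ψ.dim → ℂ))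

instance : Module (WithConv (A →ₗ[ℂ] ℂ)) ψ.Space where
  smul f v := ψ.rep f.ofConv *ᵥ (v : Fin ψ.dim → ℂ)
  one_smul v := (congrArg (· *ᵥ v) ψ.map_one).trans (Matrix.one_mulVec _)
  mul_smul f g v := (congrArg (· *ᵥ v) (ψ.map_mul f.ofConv g.ofConv)).trans
    (Matrix.mulVec_mulVec _ _ _).symm
  smul_zero _ := Matrix.mulVec_zero _
  smul_add _ _ _ := Matrix.mulVec_add _ _ _
  add_smul f g v := (congrArg (· *ᵥ v) (map_add ψ.rep f.ofConv g.ofConv)).trans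
    (Matrix.add_mulVec _ _ _)
  zero_smul v := (congrArg (· *ᵥ v) (map_zero ψ.rep)).trans (Matrix.zero_mulVec _)

instance : IsScalarTower ℂ (WithConv (A →ₗ[ℂ] ℂ)) ψ.Space where
  smul_assoc c f v := (congrArg (· *ᵥ v) (map_smul ψ.rep c f.ofConv)).trans
    (Matrix.smul_mulVec _ _ _)

instance : IsSimpleModule (WithConv (A →ₗ[ℂ] ℂ)) ψ.Space :=
  have : Nontrivial ψ.Space :=
    have : Nonempty (Fin ψ.dim) := ⟨⟨0, ψ.dim_pos⟩⟩
    inferInstanceAs (Nontrivial (Fin ψ.dim → ℂ))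
  { eq_bot_or_eq_top := fun W => by
      rcases ψ.irreducible (W.restrictScalars ℂ : Submodule ℂ ψ.Space)
        (fun f w hw => W.smul_mem (WithConv.toConv f) hw) with h | h
      · exact Or.inl ((Submodule.restrictScalars_eq_bot_iff _ _ _).1 h)
      · exact Or.inr ((Submodule.restrictScalars_eq_top_iff _ _ _).1 h) }

theorem equivalent_of_linearEquiv {ψ₁ ψ₂ : DualIrrep A}
    (E : ψ₁.Space ≃ₗ[WithConv (A →ₗ[ℂ] ℂ)] ψ₂.Space) : Equivalent ψ₁ ψ₂ := by
  let F : (Fin ψ₁.dim → ℂ) ≃ₗ[ℂ] (Fin ψ₂.dim → ℂ) := E.restrictScalars ℂ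
  have hF : ∀ f (v : Fin ψ₁.dim → ℂ), F (ψ₁.rep f *ᵥ v) = ψ₂.rep f *ᵥ F v := fun f v =>
    E.map_smul (WithConv.toConv f) v
  refine ⟨LinearMap.toMatrix' F.toLinearMap, LinearMap.toMatrix' F.symm.toLinearMap, ?_, ?_,
    fun f => ?_⟩
  · rw [← LinearMap.toMatrix'_comp]; simp
  · rw [← LinearMap.toMatrix'_comp]; simp
  · refine Matrix.toLin'.injective (LinearMap.ext fun v => ?_)
    simp [Matrix.toLin'_mul, hF]

/-- Finitely many pairwise inequivalent irreducible representations are jointly surjective. -/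
theorem exists_rep_eq {ι : Type*} [Fintype ι] (ψ : ι → DualIrrep A)
    (hψ : ∀ k l, k ≠ l → ¬ Equivalent (ψ k) (ψ l))
    (Y : ∀ k, Matrix (Fin (ψ k).dim) (Fin (ψ k).dim) ℂ) :
    ∃ f : Module.Dual ℂ A, ∀ k, (ψ k).rep f = Y k := by
  classical
  obtain ⟨r, hr⟩ := exists_smul_eq_of_pairwise_not_equiv (K := ℂ) (R := WithConv (A →ₗ[ℂ] ℂ))
    (fun k => (ψ k).Space) (fun k l hkl => ⟨fun E => hψ k l hkl (equivalent_of_linearEquiv E)⟩)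
    (fun k => Matrix.toLin' (Y k))
  exact ⟨r.ofConv, fun k => Matrix.toLin'.injective (LinearMap.ext fun v => hr k v)⟩

end DualIrrep

/-! ### Matrix-product operators as functionals -/

theorem dualMul_counit (f : Module.Dual ℂ A) :
    dualMul f (Coalgebra.counit : A →ₗ[ℂ] ℂ) = f :=
  congrArg WithConv.ofConv (mul_one (WithConv.toConv f))

theorem dualMul_apply_of_comul_eq {f g : Module.Dual ℂ A} {x a b : A}
    (h : Coalgebra.comul (R := ℂ) x = a ⊗ₜ[ℂ] b) : dualMul f g x = f a * g b := by
  simp [dualMul, h]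

/-- The bilinear convolution product of functionals. -/
def dualMulLinear : Module.Dual ℂ A →ₗ[ℂ] Module.Dual ℂ A →ₗ[ℂ] Module.Dual ℂ A :=
  LinearMap.mk₂ ℂ dualMul
    (fun f f' g => by simp [dualMul, TensorProduct.map_add_left, LinearMap.add_comp, LinearMap.comp_add])
    (fun c f g => by simp [dualMul, TensorProduct.map_smul_left, LinearMap.smul_comp, LinearMap.comp_smul])
    (fun f g g' => by simp [dualMul, TensorProduct.map_add_right, LinearMap.add_comp, LinearMap.comp_add])
    (fun c f g => by simp [dualMul, TensorProduct.map_smul_right, LinearMap.smul_comp, LinearMap.comp_smul])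

theorem dualMulLinear_apply (f g : Module.Dual ℂ A) : dualMulLinear f g = dualMul f g := rfl

variable {d : ℕ} (φ : A →⋆ₐ[ℂ] Matrix (Fin d) (Fin d) ℂ)

/-- The functional `x ↦ ⟨p|φ(x)|q⟩`. -/
def matrixCoeff (p q : Fin d) : Module.Dual ℂ A :=
  Matrix.entryLinearMap ℂ ℂ p q ∘ₗ (φ : A →ₐ[ℂ] Matrix (Fin d) (Fin d) ℂ).toLinearMap

@[simp]
theorem matrixCoeff_apply (p q : Fin d) (x : A) : matrixCoeff φ p q x = φ x p q := rfl

/-- The product of the matrix coefficients of `n + 1` sites. -/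
def coeffWord : ∀ n : ℕ, (Fin (n + 1) → Fin d) → (Fin (n + 1) → Fin d) → Module.Dual ℂ A
  | 0, i, j => matrixCoeff φ (i 0) (j 0)
  | n + 1, i, j => dualMul (coeffWord n (Fin.init i) (Fin.init j))
      (matrixCoeff φ (i (Fin.last _)) (j (Fin.last _)))

/-- The matrix on `n + 2` sites of a tensor product of matrices on `n + 1` sites and on one site. -/
def appendSite (κ : Type*) (n : ℕ) :
    Matrix (Fin (n + 1) → κ) (Fin (n + 1) → κ) ℂ ⊗[ℂ] Matrix κ κ ℂ →ₗ[ℂ]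
      Matrix (Fin (n + 2) → κ) (Fin (n + 2) → κ) ℂ :=
  TensorProduct.lift (LinearMap.mk₂ ℂ (fun P Q => Matrix.of fun i j =>
      P (Fin.init i) (Fin.init j) * Q (i (Fin.last _)) (j (Fin.last _)))
    (fun P P' Q => by ext; simp [add_mul])
    (fun c P Q => by ext; simp [mul_assoc])
    (fun P Q Q' => by ext; simp [mul_add])
    (fun c P Q => by ext; simp [mul_left_comm]))

@[simp]
theorem appendSite_tmul (κ : Type*) (n : ℕ) (P : Matrix (Fin (n + 1) → κ) (Fin (n + 1) → κ) ℂ)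
    (Q : Matrix κ κ ℂ) (i j : Fin (n + 2) → κ) :
    appendSite κ n (P ⊗ₜ Q) i j =
      P (Fin.init i) (Fin.init j) * Q (i (Fin.last _)) (j (Fin.last _)) := rfl

theorem appendSite_mul (κ : Type*) [Fintype κ] (n : ℕ)
    (s t : Matrix (Fin (n + 1) → κ) (Fin (n + 1) → κ) ℂ ⊗[ℂ] Matrix κ κ ℂ) :
    appendSite κ n (s * t) = appendSite κ n s * appendSite κ n t := by
  induction s with
  | zero => simp
  | add s s' hs hs' => rw [add_mul, map_add, map_add, hs, hs', add_mul]
  | tmul P Q =>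
    induction t with
    | zero => simp
    | add t t' ht ht' => rw [mul_add, map_add, map_add, ht, ht', mul_add]
    | tmul P' Q' =>
      ext i j
      rw [Algebra.TensorProduct.tmul_mul_tmul, appendSite_tmul, Matrix.mul_apply, Matrix.mul_apply,
        Matrix.mul_apply, Finset.sum_mul_sum, Finset.sum_comm, ← Finset.sum_product',
        ← (Fin.snocEquiv fun _ : Fin (n + 2) => κ).sum_comp]
      refine Finset.sum_congr rfl fun p _ => ?_
      simp [Fin.snocEquiv]
      ring

theorem appendSite_star (κ : Type*) (n : ℕ)
    (t : Matrix (Fin (n + 1) → κ) (Fin (n + 1) → κ) ℂ ⊗[ℂ] Matrix κ κ ℂ) :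
    appendSite κ n (star t) = star (appendSite κ n t) := by
  induction t with
  | zero => simp
  | add s t hs ht => rw [star_add, map_add, map_add, hs, ht, star_add]
  | tmul P Q => ext i j; simp [Matrix.star_apply]

/-- `mpo` as a linear map. -/
def mpoLinear (n : ℕ) : A →ₗ[ℂ] Matrix (Fin (n + 1) → Fin d) (Fin (n + 1) → Fin d) ℂ :=
  PiTensorProduct.lift (kroneckerProd (Fin d) (n + 1)) ∘ₗ
    PiTensorProduct.map (fun _ => (φ : A →ₐ[ℂ] Matrix (Fin d) (Fin d) ℂ).toLinearMap) ∘ₗ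
    iterComul A n

@[simp]
theorem mpoLinear_apply (n : ℕ) (x : A) : mpoLinear φ n x = mpo φ n x := rfl

theorem mpo_zero_apply (x : A) (i j : Fin 1 → Fin d) : mpo φ 0 x i j = φ x (i 0) (j 0) := by
  simp [mpo, iterComul, kroneckerProd]

/-- Replaces the tensor-power definition by a recursion on sites, from which multiplicativity,
star-compatibility and the entry formula follow by induction. -/
theorem mpo_succ (n : ℕ) (x : A) :
    mpo φ (n + 1) x = appendSite (Fin d) n (TensorProduct.map (mpoLinear φ n)
      (φ : A →ₐ[ℂ] Matrix (Fin d) (Fin d) ℂ).toLinearMap (Coalgebra.comul x)) := by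
  suffices h : ∀ (s : TensorPower ℂ (n + 1) A) (b : A),
      PiTensorProduct.lift (kroneckerProd (Fin d) (n + 2))
        (PiTensorProduct.map (fun _ => (φ : A →ₐ[ℂ] Matrix (Fin d) (Fin d) ℂ).toLinearMap)
          (TensorPower.mulEquiv (R := ℂ) (M := A) (n := n + 1) (m := 1)
            (s ⊗ₜ PiTensorProduct.tprod ℂ fun _ => b))) =
        appendSite (Fin d) n (PiTensorProduct.lift (kroneckerProd (Fin d) (n + 1))
          (PiTensorProduct.map (fun _ => (φ : A →ₐ[ℂ] Matrix (Fin d) (Fin d) ℂ).toLinearMap) s)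
            ⊗ₜ φ b) by
    simp only [mpo, iterComul, LinearMap.comp_apply, LinearEquiv.coe_coe]
    induction Coalgebra.comul (R := ℂ) x with
    | zero => simp
    | add s t hs ht => simp only [map_add, hs, ht]
    | tmul a b =>
      rw [TensorProduct.map_tmul, TensorProduct.map_tmul, LinearEquiv.coe_coe,
        PiTensorProduct.subsingletonEquiv_symm_apply']
      exact h (iterComul A n a) b
  intro s b
  induction s using PiTensorProduct.induction_on with
  | smul_tprod r a =>
    rw [← TensorProduct.smul_tmul', map_smul, map_smul, map_smul, map_smul, map_smul,
      ← TensorProduct.smul_tmul', map_smul, ← TensorPower.gMul_def, TensorPower.tprod_mul_tprod]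
    congr 1
    ext i j
    simp [kroneckerProd, Fin.prod_univ_castSucc (n := n + 1), Fin.init, Fin.append_right_eq_snoc]
  | add s t hs ht => simp only [TensorProduct.add_tmul, map_add, hs, ht]

theorem mpo_apply (n : ℕ) (x : A) (i j : Fin (n + 1) → Fin d) :
    mpo φ n x i j = coeffWord φ n i j x := by
  induction n generalizing x with
  | zero => exact mpo_zero_apply φ x i j
  | succ n ih =>
    rw [mpo_succ, coeffWord, dualMul, LinearMap.comp_apply, LinearMap.comp_apply]
    induction Coalgebra.comul (R := ℂ) x with
    | zero => simp
    | add s t hs ht => rw [map_add, map_add, map_add, map_add, Matrix.add_apply, hs, ht]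
    | tmul a b => simp [ih]

theorem mpo_mul (n : ℕ) (x y : A) : mpo φ n (x * y) = mpo φ n x * mpo φ n y := by
  induction n generalizing x y with
  | zero =>
    ext i j
    simp_rw [Matrix.mul_apply, mpo_zero_apply, map_mul, Matrix.mul_apply]
    rw [← (Equiv.funUnique (Fin 1) (Fin d)).sum_comp]
    rfl
  | succ n ih =>
    rw [mpo_succ, mpo_succ, mpo_succ, comul_mul, ← appendSite_mul]
    congr 1
    induction Coalgebra.comul (R := ℂ) x with
    | zero => simp
    | add s s' hs hs' => rw [add_mul, map_add, map_add, hs, hs', add_mul]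
    | tmul a b =>
      induction Coalgebra.comul (R := ℂ) y with
      | zero => simp
      | add t t' ht ht' => rw [mul_add, map_add, map_add, ht, ht', mul_add]
      | tmul a' b' => simp [ih]

theorem mpo_star (n : ℕ) (x : A) : mpo φ n (star x) = star (mpo φ n x) := by
  induction n generalizing x with
  | zero =>
    ext i j
    simp [mpo_zero_apply, Matrix.star_apply, map_star]
  | succ n ih =>
    rw [mpo_succ, mpo_succ, comul_star, ← appendSite_star]
    congr 1
    induction Coalgebra.comul (R := ℂ) x with
    | zero => simp
    | add s t hs ht => rw [star_add, map_add, map_add, hs, ht, star_add]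
    | tmul a b => simp [ih, map_star]

/-! ### Unitarity -/

theorem mpuOperator_eq (e u : Irr A →₀ ℂ) (n : ℕ) :
    mpuOperator φ e u n = 1 + (mpo φ n (cocentralSum u) - mpo φ n (cocentralSum e)) := by
  simp_rw [mpuOperator, cocentralSum, ← mpoLinear_apply, map_finsuppSum, map_smul]
  rw [Finsupp.sum_sub_index fun a b c => sub_smul b c _]

/-- Expand the product with the adjoint and use `p v* = (v p)* = v*`; for square matrices a
one-sided inverse suffices. -/
theorem one_add_mpo_sub_mem_unitaryGroup {p v : A} (hp : star p = p) (hpp : p * p = p)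
    (hvp : v * p = v) (hvv : v * star v = p) (n : ℕ) :
    1 + (mpo φ n v - mpo φ n p) ∈ Matrix.unitaryGroup (Fin (n + 1) → Fin d) ℂ := by
  have hpv : p * star v = star v := by conv_rhs => rw [← hvp, star_mul, hp]
  rw [Matrix.mem_unitaryGroup_iff, star_add, star_sub, star_one, ← mpo_star, ← mpo_star, hp]
  simp only [mul_add, add_mul, mul_sub, sub_mul, ← mpo_mul, hvv, hpp, hvp, hpv, one_mul, mul_one]
  abel

theorem mpuOperator_mem_unitaryGroup {e u : Irr A →₀ ℂ}
    (he : IsCocentralIdentity (cocentralSum e))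
    (hu' : cocentralSum u * star (cocentralSum u) = cocentralSum e) (n : ℕ) :
    mpuOperator φ e u n ∈ Matrix.unitaryGroup (Fin (n + 1) → Fin d) ℂ := by
  have hmem : ∀ c : Irr A →₀ ℂ, cocentralSum c ∈ cocentralSpan A := fun c =>
    Submodule.sum_mem _ fun a _ => Submodule.smul_mem _ _ (Submodule.subset_span ⟨a, rfl⟩)
  rw [mpuOperator_eq]
  exact one_add_mpo_sub_mem_unitaryGroup φ (by rw [← hu', star_mul, star_star])
    (he.2 _ (hmem e)).1 (he.2 _ (hmem u)).2 hu' n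

end CStarWeakHopfAlgebra

/-! ### Blocked tensors and the identity tensor -/

namespace MPOTensor

variable {κ β : Type*} [Fintype β] [DecidableEq β]

theorem block_succ (T : MPOTensor κ β) (n : ℕ) (i j : Fin (n + 1) → κ) :
    T.block (n + 1) i j =
      T.block n (Fin.init i) (Fin.init j) * T (i (Fin.last n)) (j (Fin.last n)) := by
  rw [block, List.ofFn_succ', List.concat_eq_append, List.prod_append, List.prod_singleton]
  rfl

theorem block_one_apply (T : MPOTensor κ β) (i j : Fin 1 → κ) : T.block 1 i j = T (i 0) (j 0) := by
  simp [block]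

/-- The tensor of bond dimension one of the identity operator. -/
def identityTensor (κ : Type*) [DecidableEq κ] : MPOTensor κ (Fin 1) :=
  fun p q => (1 : Matrix κ κ ℂ) p q • 1

theorem one_apply_init_last [DecidableEq κ] (n : ℕ) (i j : Fin (n + 1) → κ) :
    (1 : Matrix (Fin (n + 1) → κ) (Fin (n + 1) → κ) ℂ) i j =
      (1 : Matrix (Fin n → κ) (Fin n → κ) ℂ) (Fin.init i) (Fin.init j) *
        (1 : Matrix κ κ ℂ) (i (Fin.last n)) (j (Fin.last n)) := by
  have h : i = j ↔ Fin.init i = Fin.init j ∧ i (Fin.last n) = j (Fin.last n) := by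
    refine ⟨fun h => h ▸ ⟨rfl, rfl⟩, fun h => ?_⟩
    rw [← Fin.snoc_init_self i, ← Fin.snoc_init_self j, h.1, h.2]
  simp [Matrix.one_apply, h, ite_and, mul_comm]

theorem one_apply_snoc [DecidableEq κ] (n : ℕ) (i j : Fin n → κ) (p q : κ) :
    (1 : Matrix (Fin (n + 1) → κ) (Fin (n + 1) → κ) ℂ) (Fin.snoc i p) (Fin.snoc j q) =
      (1 : Matrix (Fin n → κ) (Fin n → κ) ℂ) i j * (1 : Matrix κ κ ℂ) p q := by
  rw [one_apply_init_last, Fin.init_snoc, Fin.init_snoc, Fin.snoc_last, Fin.snoc_last]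

theorem one_apply_fin_one [DecidableEq κ] (i j : Fin 1 → κ) :
    (1 : Matrix (Fin 1 → κ) (Fin 1 → κ) ℂ) i j = (1 : Matrix κ κ ℂ) (i 0) (j 0) := by
  simp [Matrix.one_apply, funext_iff]

theorem block_identityTensor [DecidableEq κ] (n : ℕ) (i j : Fin n → κ) :
    (identityTensor κ).block n i j = (1 : Matrix (Fin n → κ) (Fin n → κ) ℂ) i j • 1 := by
  induction n with
  | zero =>
    obtain rfl := Subsingleton.elim i j
    simp [block]
  | succ n ih => rw [block_succ, ih, one_apply_init_last, identityTensor]; simp [smul_smul, mul_comm]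

theorem closedMPO_identityTensor [DecidableEq κ] (n : ℕ) :
    (identityTensor κ).closedMPO 1 n = 1 := by
  ext i j
  simp [closedMPO, block_identityTensor]

theorem isInjective_identityTensor [DecidableEq κ] [Nonempty κ] :
    (identityTensor κ).IsInjective := by
  intro X Y h
  obtain ⟨p⟩ := ‹Nonempty κ›
  have h' := congrFun (congrFun h p) p
  ext a b
  rw [Subsingleton.elim a 0, Subsingleton.elim b 0]
  simpa [identityTensor, Matrix.trace] using h'

end MPOTensor

/-! ### Matrix coefficients and their words -/

namespace CStarWeakHopfAlgebra

open MPOTensor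

variable {A : Type*} [CStarAlgebra A] [FiniteDimensional ℂ A] [CStarWeakHopfAlgebra A]

variable {d : ℕ} {φ : A →⋆ₐ[ℂ] Matrix (Fin d) (Fin d) ℂ}

/-- An element killed by all coefficients is in the kernel of `φ`, hence zero; in finite dimension a
separating family of functionals spans the dual. -/
theorem span_matrixCoeff (hφ : Function.Injective φ) :
    Submodule.span ℂ (Set.range fun p : Fin d × Fin d => matrixCoeff φ p.1 p.2) = ⊤ := by
  set W := Submodule.span ℂ (Set.range fun p : Fin d × Fin d => matrixCoeff φ p.1 p.2)
  have h : W.dualCoannihilator = ⊥ := by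
    refine (Submodule.eq_bot_iff _).2 fun x hx => hφ ?_
    ext p q
    rw [map_zero]
    exact (Submodule.mem_dualCoannihilator _).1 hx _ (Submodule.subset_span ⟨(p, q), rfl⟩)
  rw [← Subspace.dualCoannihilator_dualAnnihilator_eq (W := W), h, Submodule.dualAnnihilator_bot]

theorem eq_of_matrixCoeff {V : Type*} [AddCommGroup V] [Module ℂ V] (hφ : Function.Injective φ)
    {L L' : Module.Dual ℂ A →ₗ[ℂ] V}
    (h : ∀ p q, L (matrixCoeff φ p q) = L' (matrixCoeff φ p q)) : L = L' :=
  LinearMap.ext_on_range (span_matrixCoeff hφ) fun p => h p.1 p.2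

theorem coeffWord_snoc (n : ℕ) (i j : Fin (n + 1) → Fin d) (p q : Fin d) :
    coeffWord φ (n + 1) (Fin.snoc i p) (Fin.snoc j q) =
      dualMul (coeffWord φ n i j) (matrixCoeff φ p q) := by
  simp [coeffWord]

theorem eq_zero_of_coeffWord {V : Type*} [AddCommGroup V] [Module ℂ V]
    (hφ : Function.Injective φ) (n : ℕ) {L : Module.Dual ℂ A →ₗ[ℂ] V}
    (h : ∀ i j, L (coeffWord φ n i j) = 0) : L = 0 := by
  induction n with
  | zero => exact eq_of_matrixCoeff hφ fun p q => h (fun _ => p) (fun _ => q)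
  | succ n ih =>
    refine ih fun i j => ?_
    -- Coefficients span the dual, so the last letter may be any functional; taking it to be the
    -- unit `ε` shortens the word.
    have h' : L ∘ₗ dualMulLinear (coeffWord φ n i j) = 0 := eq_of_matrixCoeff hφ fun p q => by
      rw [LinearMap.zero_apply, LinearMap.comp_apply, dualMulLinear_apply, ← coeffWord_snoc, h]
    simpa [dualMulLinear_apply, dualMul_counit] using
      LinearMap.congr_fun h' (Coalgebra.counit : A →ₗ[ℂ] ℂ)

theorem mpo_injective (hφ : Function.Injective φ) (n : ℕ) : Function.Injective (mpo φ n) := by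
  refine (injective_iff_map_eq_zero (mpoLinear φ n)).2 fun x hx => ?_
  rw [← Module.forall_dual_apply_eq_zero_iff ℂ]
  refine LinearMap.congr_fun (eq_zero_of_coeffWord hφ n (L := Module.Dual.eval ℂ A x) fun i j => ?_)
  rw [Module.Dual.eval_apply, ← mpo_apply, ← mpoLinear_apply, hx, Matrix.zero_apply]

/-! ### The tensors of the irreducible representations -/

/-- The tensor `ψ(φ_{pq})` of a representation of the dual algebra. -/
def DualIrrep.tensor (ψ : DualIrrep A) (φ : A →⋆ₐ[ℂ] Matrix (Fin d) (Fin d) ℂ) :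
    MPOTensor (Fin d) (Fin ψ.dim) :=
  fun p q => ψ.rep (matrixCoeff φ p q)

theorem DualIrrep.block_tensor (ψ : DualIrrep A) (n : ℕ) (i j : Fin (n + 1) → Fin d) :
    (ψ.tensor φ).block (n + 1) i j = ψ.rep (coeffWord φ n i j) := by
  induction n with
  | zero => rw [block_one_apply]; rfl
  | succ n ih => rw [block_succ, ih, coeffWord, ψ.map_mul]; rfl

theorem mpo_cocentral (ψ : DualIrrep A) (n : ℕ) :
    mpo φ n (cocentral (Quotient.mk (DualIrrep.setoid A) ψ)) =
      (ψ.tensor φ).closedMPO 1 (n + 1) := by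
  ext i j
  rw [mpo_apply, apply_cocentral, closedMPO, Matrix.of_apply, one_mul, ψ.block_tensor]

/-- The functional `Tr[X ψ(·)]` is determined by its values on coefficients, `ψ` is onto the full
matrix algebra, and the trace form is nondegenerate. -/
theorem DualIrrep.isInjective_tensor (ψ : DualIrrep A) (hφ : Function.Injective φ) :
    (ψ.tensor φ).IsInjective := by
  intro X X' h
  obtain hL : Matrix.traceLinearMap _ ℂ ℂ ∘ₗ LinearMap.mulLeft ℂ X ∘ₗ ψ.rep =
      Matrix.traceLinearMap _ ℂ ℂ ∘ₗ LinearMap.mulLeft ℂ X' ∘ₗ ψ.rep :=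
    eq_of_matrixCoeff hφ fun p q => congrFun (congrFun h p) q
  refine Matrix.ext_iff_trace_mul_right.2 fun Y => ?_
  obtain ⟨f, hf⟩ := exists_rep_eq (fun _ : Unit => ψ) (fun k l h => (h rfl).elim) fun _ => Y
  rw [← hf ()]
  exact LinearMap.congr_fun hL f

/-- The matrix coefficients of inequivalent irreducible representations are independent. -/
theorem eq_zero_of_sum_trace_mul_rep {s : Finset (Irr A)}
    (X : ∀ a : s, Matrix (Fin (Quotient.out a.1).dim) (Fin (Quotient.out a.1).dim) ℂ)
    (h : ∀ f, ∑ a : s, (X a * (Quotient.out a.1).rep f).trace = 0) : X = 0 := by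
  classical
  funext a
  refine Matrix.ext_iff_trace_mul_right.2 fun Y => ?_
  obtain ⟨f, hf⟩ := DualIrrep.exists_rep_eq (fun a : s => Quotient.out a.1)
    (fun a b hab hE => hab (Subtype.ext (Quotient.out_equiv_out.1 hE))) (Pi.single a Y)
  have h' := h f
  rw [Finset.sum_eq_single a (fun b _ hb => by simp [hf, hb]) (by simp), hf, Pi.single_eq_same] at h'
  simpa using h'

/-! ### The identity operator -/

theorem mpo_zero_one : mpo φ 0 (1 : A) = 1 := by
  ext i j
  rw [mpo_zero_apply, map_one, one_apply_fin_one]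

theorem mpo_one (h : Coalgebra.comul (R := ℂ) (1 : A) = 1 ⊗ₜ 1) (n : ℕ) : mpo φ n 1 = 1 := by
  induction n with
  | zero => exact mpo_zero_one
  | succ n ih =>
    ext i j
    rw [mpo_succ, h, TensorProduct.map_tmul, appendSite_tmul, mpoLinear_apply, ih,
      one_apply_init_last (n + 1)]
    simp

/-- Apply `ε` to the last site. The entries of the one-site identity are the values of the
coefficients at `1`, so this contraction turns that factor into `ε(1)`. -/
theorem mpo_eq_smul_one_of_succ (hφ : Function.Injective φ) {n : ℕ} {x : A} {c : ℂ}
    (h : mpo φ (n + 1) x = c • 1) : mpo φ n x = (c * Coalgebra.counit (1 : A)) • 1 := by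
  ext i j
  have hL : Module.Dual.eval ℂ A x ∘ₗ dualMulLinear (coeffWord φ n i j) =
      (c * (1 : Matrix (Fin (n + 1) → Fin d) (Fin (n + 1) → Fin d) ℂ) i j) •
        Module.Dual.eval ℂ A 1 := eq_of_matrixCoeff hφ fun p q => by
    have h' := congrFun (congrFun h (Fin.snoc i p)) (Fin.snoc j q)
    rw [mpo_apply, coeffWord_snoc, Matrix.smul_apply, one_apply_snoc] at h'
    simpa [dualMulLinear_apply, mul_assoc] using h'
  have h' := LinearMap.congr_fun hL (Coalgebra.counit : A →ₗ[ℂ] ℂ)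
  rw [LinearMap.comp_apply, dualMulLinear_apply, dualMul_counit] at h'
  simpa [mpo_apply, mul_right_comm] using h'

theorem tensor_ext_dual {V : Type*} [AddCommGroup V] [Module ℂ V] [FiniteDimensional ℂ V]
    {s t : V ⊗[ℂ] V} (h : ∀ f g : Module.Dual ℂ V,
      LinearMap.mul' ℂ ℂ (TensorProduct.map f g s) = LinearMap.mul' ℂ ℂ (TensorProduct.map f g t)) :
    s = t := by
  let b := Module.finBasis ℂ V
  have hb : ∀ i, (b.tensorProduct b).coord i =
      LinearMap.mul' ℂ ℂ ∘ₗ TensorProduct.map (b.coord i.1) (b.coord i.2) := fun i =>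
    TensorProduct.ext' fun x y => by
      simp only [Module.Basis.coord_apply, LinearMap.comp_apply, TensorProduct.map_tmul,
        LinearMap.mul'_apply]
      exact (Module.Basis.tensorProduct_repr_tmul_apply b b x y i.1 i.2).trans
        (by rw [smul_eq_mul, mul_comm])
  refine (b.tensorProduct b).ext_elem fun i => ?_
  rw [← Module.Basis.coord_apply, ← Module.Basis.coord_apply, hb]
  exact h _ _

/-- The hypothesis says that `f ⊗ g` takes equal values on `Δ(1)` and `1 ⊗ 1` when `f` and `g` are
coefficients; bilinearity extends this to all functionals, one slot at a time. -/
theorem comul_one_of_mpo_one (hφ : Function.Injective φ) (h : mpo φ 1 (1 : A) = 1) :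
    Coalgebra.comul (R := ℂ) (1 : A) = 1 ⊗ₜ 1 := by
  refine tensor_ext_dual fun f g => ?_
  suffices H : Module.Dual.eval ℂ A 1 ∘ₗ dualMulLinear f = f 1 • Module.Dual.eval ℂ A 1 by
    simpa [dualMulLinear_apply, dualMul] using LinearMap.congr_fun H g
  refine eq_of_matrixCoeff hφ fun r s => ?_
  suffices H : Module.Dual.eval ℂ A 1 ∘ₗ dualMulLinear.flip (matrixCoeff φ r s) =
      matrixCoeff φ r s 1 • Module.Dual.eval ℂ A 1 by
    simpa [mul_comm] using LinearMap.congr_fun H f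
  refine eq_of_matrixCoeff hφ fun p q => ?_
  have h' := congrFun (congrFun h (Fin.snoc (fun _ => p) r)) (Fin.snoc (fun _ => q) s)
  rw [mpo_apply, coeffWord_snoc, one_apply_snoc, one_apply_fin_one] at h'
  simpa [dualMulLinear_apply, coeffWord, mul_comm] using h'

/-- Contracting sites one by one descends to two sites, with the scalar staying nonzero. A further
contraction shows that `x` is a multiple of `1`, which makes the two-site image of `1` a nonzero
scalar; being idempotent, it is the identity. -/
theorem comul_one_of_mpo_eq_smul_one [Nonempty (Fin d)] (hφ : Function.Injective φ) {n : ℕ}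
    {x : A} {c : ℂ} (hc : c ≠ 0) (h : mpo φ (n + 1) x = c • 1) :
    Coalgebra.comul (R := ℂ) (1 : A) = 1 ⊗ₜ 1 := by
  -- If `ε(1) = 0`, one contraction would give `MPO(x) = 0`, so `x = 0`, against `c ≠ 0`.
  have hε : (Coalgebra.counit (1 : A) : ℂ) ≠ 0 := by
    intro h0
    have hx := mpo_eq_smul_one_of_succ hφ h
    rw [h0, mul_zero, zero_smul, ← map_zero (mpoLinear φ n)] at hx
    rw [mpo_injective hφ n hx, ← mpoLinear_apply, map_zero] at h
    exact smul_ne_zero hc one_ne_zero h.symm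
  induction n generalizing c with
  | succ n ih => exact ih (mul_ne_zero hc hε) (mpo_eq_smul_one_of_succ hφ h)
  | zero =>
    set k : ℂ := c * Coalgebra.counit (1 : A)
    have hk : k ≠ 0 := mul_ne_zero hc hε
    have hx : x = k • 1 := mpo_injective hφ 0 <| by
      rw [mpo_eq_smul_one_of_succ hφ h, ← mpoLinear_apply, map_smul, mpoLinear_apply,
        mpo_zero_one]
    rw [hx, ← mpoLinear_apply, map_smul, mpoLinear_apply] at h
    have h1 : mpo φ 1 (1 : A) = (k⁻¹ * c) • 1 := by
      rw [mul_smul, ← h, smul_smul, inv_mul_cancel₀ hk, one_smul]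
    have hidem : (k⁻¹ * c) • (k⁻¹ * c) • (1 : Matrix (Fin 2 → Fin d) (Fin 2 → Fin d) ℂ) =
        (k⁻¹ * c) • 1 := by
      have h2 := mpo_mul φ 1 (1 : A) 1
      rw [mul_one, h1, smul_mul_assoc, one_mul] at h2
      exact h2.symm
    refine comul_one_of_mpo_one hφ ?_
    rw [h1]
    exact smul_right_injective _ (mul_ne_zero (inv_ne_zero hk) hc) hidem

theorem counit_one_of_comul_one [Nontrivial A]
    (h : Coalgebra.comul (R := ℂ) (1 : A) = 1 ⊗ₜ 1) : (Coalgebra.counit (1 : A) : ℂ) = 1 := by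
  have h' := Coalgebra.rTensor_counit_comul (R := ℂ) (1 : A)
  rw [h, LinearMap.rTensor_tmul] at h'
  have h'' := congrArg (TensorProduct.lid ℂ A) h'
  rw [TensorProduct.lid_tmul, TensorProduct.lid_tmul] at h''
  exact smul_left_injective ℂ (one_ne_zero (α := A)) h''

theorem antipode_one_of_comul_one [Nontrivial A]
    (h : Coalgebra.comul (R := ℂ) (1 : A) = 1 ⊗ₜ 1) : antipode (1 : A) = 1 := by
  simpa [h, counit_one_of_comul_one h] using antipode_mul_id (1 : A)

/-- Evaluation at a group-like identity is a one-dimensional representation of the dual. -/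
def evalOneIrrep [Nontrivial A] (h : Coalgebra.comul (R := ℂ) (1 : A) = 1 ⊗ₜ 1) : DualIrrep A where
  dim := 1
  dim_pos := one_pos
  rep := LinearMap.smulRight (Module.Dual.eval ℂ A 1) 1
  map_mul f g := by simp [dualMul_apply_of_comul_eq h, smul_smul, mul_comm]
  map_star f := by simp [dualStar, antipode_one_of_comul_one h]
  map_one := by simp [counit_one_of_comul_one h]
  irreducible W _ := by
    have : IsSimpleOrder (Submodule ℂ (Fin 1 → ℂ)) :=
      is_simple_module_of_finrank_eq_one (Module.finrank_fin_fun ℂ)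
    exact eq_bot_or_eq_top W

theorem cocentral_evalOneIrrep [Nontrivial A]
    (h : Coalgebra.comul (R := ℂ) (1 : A) = 1 ⊗ₜ 1) :
    cocentral (Quotient.mk (DualIrrep.setoid A) (evalOneIrrep h)) = 1 := by
  rw [← sub_eq_zero, ← Module.forall_dual_apply_eq_zero_iff ℂ]
  intro f
  rw [map_sub, apply_cocentral, sub_eq_zero]
  change (f 1 • (1 : Matrix (Fin 1) (Fin 1) ℂ)).trace = f 1
  simp

theorem exists_mpuOperator_eq_sum_mpo (h : Coalgebra.comul (R := ℂ) (1 : A) = 1 ⊗ₜ 1)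
    [Nonempty (Fin d)] (φ : A →⋆ₐ[ℂ] Matrix (Fin d) (Fin d) ℂ) (e u : Irr A →₀ ℂ) :
    ∃ c : Irr A →₀ ℂ, ∀ n, mpuOperator φ e u n = mpo φ n (cocentralSum c) := by
  have : Nontrivial A := (φ : A →+* Matrix (Fin d) (Fin d) ℂ).domain_nontrivial
  let a : Irr A := Quotient.mk (DualIrrep.setoid A) (evalOneIrrep h)
  have ha : cocentral a = 1 := cocentral_evalOneIrrep h
  refine ⟨Finsupp.single a 1 + (u - e), fun n => ?_⟩
  rw [mpuOperator_eq, ← mpo_one h n, ← ha]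
  simp_rw [← mpoLinear_apply]
  rw [← map_sub, ← map_add, cocentralSum, cocentralSum, cocentralSum,
    Finsupp.sum_add_index' (by simp) (fun _ _ _ => add_smul _ _ _),
    Finsupp.sum_sub_index fun a b c => sub_smul b c _, Finsupp.sum_single_index (by simp), one_smul]

end CStarWeakHopfAlgebra

/-! ### Direct sums, open boundaries and the rank condition -/

namespace MPOTensor

theorem trace_mul_block_identityTensor {κ : Type*} [DecidableEq κ] (X : Matrix (Fin 1) (Fin 1) ℂ)
    (n : ℕ) (i j : Fin n → κ) :
    (X * (identityTensor κ).block n i j).trace =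
      X.trace * (1 : Matrix (Fin n → κ) (Fin n → κ) ℂ) i j := by
  rw [block_identityTensor, mul_smul_comm, mul_one, Matrix.trace_smul, smul_eq_mul, mul_comm]

theorem matrix_fin_one_eq_zero_of_trace {X : Matrix (Fin 1) (Fin 1) ℂ} (h : X.trace = 0) :
    X = 0 := by
  ext a b
  rw [Subsingleton.elim a 0, Subsingleton.elim b 0]
  simpa [Matrix.trace] using h

section Blocks

variable {κ : Type*} {g : ℕ} {D : Fin g → ℕ}

theorem block_directSum (T : ∀ k, MPOTensor κ (Fin (D k))) (n : ℕ) (i j : Fin n → κ) :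
    (directSum T).block n i j = Matrix.blockDiagonal' fun k => (T k).block n i j := by
  induction n with
  | zero => simp only [block, List.ofFn_zero, List.prod_nil]; exact Matrix.blockDiagonal'_one.symm
  | succ n ih => simp only [block_succ, ih, directSum, Matrix.blockDiagonal'_mul]

theorem block_openTensor (T : ∀ k, MPOTensor κ (Fin (D k))) (n : ℕ) (i j : Fin n → κ) :
    (openTensor T).block n i j = Matrix.blockDiagonal' fun k =>
      Matrix.kroneckerMap (· * ·) (1 : Matrix (Fin (D k)) (Fin (D k)) ℂ) ((T k).block n i j) := by
  induction n with
  | zero =>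
    simp only [block, List.ofFn_zero, List.prod_nil]
    rw [← Matrix.blockDiagonal'_one]
    congr 1
    funext k
    exact Matrix.one_kronecker_one.symm
  | succ n ih =>
    simp only [block_succ, ih, openTensor, ← Matrix.blockDiagonal'_mul]
    congr 1
    funext k
    exact (Matrix.mul_kronecker_mul _ _ _ _).symm.trans (by rw [one_mul])

theorem closedMPO_directSum (T : ∀ k, MPOTensor κ (Fin (D k)))
    (b : ∀ k, Matrix (Fin (D k)) (Fin (D k)) ℂ) (n : ℕ) :
    (directSum T).closedMPO (Matrix.blockDiagonal' b) n = ∑ k, (T k).closedMPO (b k) n := by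
  ext i j
  rw [Matrix.sum_apply]
  simp only [closedMPO, Matrix.of_apply, block_directSum, ← Matrix.blockDiagonal'_mul,
    Matrix.trace_blockDiagonal']

theorem openLeft_vecMul (T : ∀ k, MPOTensor κ (Fin (D k)))
    (b : ∀ k, Matrix (Fin (D k)) (Fin (D k)) ℂ) (n : ℕ) (i j : Fin n → κ)
    (s : Σ k, Fin (D k) × Fin (D k)) :
    (openLeft b ᵥ* (openTensor T).block n i j) s =
      (b s.1 * (T s.1).block n i j) s.2.1 s.2.2 := by
  obtain ⟨k, α, β⟩ := s
  rw [block_openTensor, Matrix.vecMul, dotProduct, Fintype.sum_sigma, Finset.sum_eq_single k]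
  · simp [openLeft, Fintype.sum_prod_type, Matrix.one_apply, Matrix.mul_apply]
  · intro l _ hl
    simp [Matrix.blockDiagonal'_apply_ne _ _ _ hl]
  · simp

theorem mulVec_openRight (T : ∀ k, MPOTensor κ (Fin (D k))) (n : ℕ) (i j : Fin n → κ)
    (s : Σ k, Fin (D k) × Fin (D k)) :
    ((openTensor T).block n i j *ᵥ openRight D) s = (T s.1).block n i j s.2.2 s.2.1 := by
  obtain ⟨k, α, β⟩ := s
  rw [block_openTensor, Matrix.mulVec, dotProduct, Fintype.sum_sigma, Finset.sum_eq_single k]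
  · simp [openRight, Fintype.sum_prod_type, Matrix.one_apply]
  · intro l _ hl
    simp [Matrix.blockDiagonal'_apply_ne _ _ _ hl.symm]
  · simp

theorem openMPO_openTensor (T : ∀ k, MPOTensor κ (Fin (D k)))
    (b : ∀ k, Matrix (Fin (D k)) (Fin (D k)) ℂ) (n : ℕ) :
    (openTensor T).openMPO (openLeft b) (openRight D) n = ∑ k, (T k).closedMPO (b k) n := by
  ext i j
  rw [Matrix.sum_apply, openMPO, Matrix.of_apply, dotProduct, Fintype.sum_sigma]
  refine Finset.sum_congr rfl fun k _ => ?_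
  simp only [mulVec_openRight, openLeft, closedMPO, Matrix.of_apply, Fintype.sum_prod_type,
    Matrix.trace, Matrix.diag, Matrix.mul_apply]

end Blocks

theorem rank_eq_card_of_injective {m n : Type*} [Fintype n] (M : Matrix m n ℂ)
    (h : ∀ v, M *ᵥ v = 0 → v = 0) : M.rank = Fintype.card n := by
  rw [Matrix.rank, LinearMap.finrank_range_of_inj ((injective_iff_map_eq_zero M.mulVecLin).2 h),
    Module.finrank_fintype_fun_eq_card]

/-- A bond vector is a family of matrices, and contracting it with either boundary gives `∑ Tr[X_k
T_k]` over words; joint spanning says that this pairing has no kernel. -/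
theorem rankCondition_block_openTensor {κ : Type*} [Fintype κ] {g : ℕ} {D : Fin g → ℕ}
    (T : ∀ k, MPOTensor κ (Fin (D k))) {c : Fin g → ℂ} (hc : ∀ k, c k ≠ 0) {q : ℕ}
    (hspan : ∀ X : ∀ k, Matrix (Fin (D k)) (Fin (D k)) ℂ,
      (∀ i j, ∑ k, (X k * (T k).block q i j).trace = 0) → X = 0) :
    ((openTensor T).block q).RankCondition (openLeft fun k => c k • 1) (openRight D) := by
  constructor
  · refine rank_eq_card_of_injective _ fun v hv => ?_
    -- The left boundary exposes `(T_k)_{αβ}`, so `v` enters transposed; the right boundary already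
    -- exposes the transpose.
    have hX := hspan (fun k => Matrix.of fun β α => c k * v ⟨k, α, β⟩) fun i j => by
      rw [← show _ = (0 : ℂ) from congrFun hv (i, j), Matrix.mulVec, dotProduct, Fintype.sum_sigma]
      refine Finset.sum_congr rfl fun k _ => ?_
      have hl : ∀ s : Fin (D k) × Fin (D k), (openLeft (fun k => c k • 1) ᵥ*
          (openTensor T).block q i j) ⟨k, s⟩ = c k * (T k).block q i j s.1 s.2 := fun s => by
        rw [openLeft_vecMul, smul_mul_assoc, one_mul, Matrix.smul_apply, smul_eq_mul]
      simp only [Matrix.of_apply, hl, Fintype.sum_prod_type, Matrix.trace, Matrix.diag,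
        Matrix.mul_apply]
      rw [Finset.sum_comm]
      exact Finset.sum_congr rfl fun _ _ => Finset.sum_congr rfl fun _ _ => by ring
    funext ⟨k, α, β⟩
    exact (mul_eq_zero.1 (congrFun (congrFun (congrFun hX k) β) α)).resolve_left (hc k)
  · refine rank_eq_card_of_injective _ fun v hv => ?_
    have hX := hspan (fun k => Matrix.of fun α β => v ⟨k, α, β⟩) fun i j => by
      rw [← show _ = (0 : ℂ) from congrFun hv (i, j), Matrix.mulVec, dotProduct, Fintype.sum_sigma]
      refine Finset.sum_congr rfl fun k _ => ?_
      simp only [Matrix.of_apply, mulVec_openRight, Fintype.sum_prod_type, Matrix.trace, Matrix.diag,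
        Matrix.mul_apply]
      exact Finset.sum_congr rfl fun _ _ => Finset.sum_congr rfl fun _ _ => mul_comm _ _
    funext ⟨k, α, β⟩
    exact congrFun (congrFun (congrFun hX k) α) β

/-- A linear relation between the closed MPOs is the case of scalar matrices `X_k`; positive bond
dimension lets the scalar be read off a diagonal entry. -/
theorem independent_of_span {κ : Type*} {g : ℕ} {D : Fin g → ℕ}
    (T : ∀ k, MPOTensor κ (Fin (D k))) (hD : ∀ k, 0 < D k) (N₀ : ℕ)
    (hspan : ∀ q ≥ N₀, ∀ X : ∀ k, Matrix (Fin (D k)) (Fin (D k)) ℂ,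
      (∀ i j, ∑ k, (X k * (T k).block q i j).trace = 0) → X = 0) : Independent T := by
  refine ⟨N₀, fun N hN => Fintype.linearIndependent_iff.2 fun c hc k => ?_⟩
  have hX := hspan N hN (fun k => c k • 1) fun i j => by
    rw [← show _ = (0 : ℂ) from congrFun (congrFun hc i) j, Matrix.sum_apply]
    refine Finset.sum_congr rfl fun k _ => ?_
    simp [closedMPO]
  have h := congrFun (congrFun (congrFun hX k) ⟨0, hD k⟩) ⟨0, hD k⟩
  simpa using h

/-- Blocks with scalar boundary operators whose words of length at least two are jointly spanning
give a matrix-product unitary with all the required properties. -/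
theorem exists_mpu_of_span {d : ℕ} {ι : Type*} [Fintype ι] (D : ι → ℕ)
    (T : ∀ k, MPOTensor (Fin d) (Fin (D k))) (c : ι → ℂ)
    (U : ∀ n : ℕ, Matrix (Fin (n + 1) → Fin d) (Fin (n + 1) → Fin d) ℂ)
    (hU : ∀ n, U n ∈ Matrix.unitaryGroup (Fin (n + 1) → Fin d) ℂ)
    (hUT : ∀ n, U n = ∑ k, c k • (T k).closedMPO 1 (n + 1))
    (hc : ∀ k, c k ≠ 0) (hD : ∀ k, 0 < D k) (hT : ∀ k, (T k).IsInjective)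
    (hspan : ∀ n ≥ 1, ∀ X : ∀ k, Matrix (Fin (D k)) (Fin (D k)) ℂ,
      (∀ i j, ∑ k, (X k * (T k).block (n + 1) i j).trace = 0) → X = 0) :
    ∃ (g : ℕ) (D : Fin g → ℕ) (T : ∀ k, MPOTensor (Fin d) (Fin (D k)))
      (b : ∀ k, Matrix (Fin (D k)) (Fin (D k)) ℂ),
      (∀ n : ℕ, (directSum T).closedMPO (Matrix.blockDiagonal' b) (n + 1) = U n) ∧
      (directSum T).IsMPU (Matrix.blockDiagonal' b) ∧
      (∀ k, (T k).IsInjective) ∧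
      Independent T ∧
      (∀ k, IsUnit (b k)) ∧
      (∀ n : ℕ, (openTensor T).openMPO (openLeft b) (openRight D) (n + 1) = U n) ∧
      (openTensor T).IsOpenMPU (openLeft b) (openRight D) ∧
      (∀ q : ℕ, 2 ≤ q →
        ((openTensor T).block q).RankCondition (openLeft b) (openRight D)) := by
  let E := (Fintype.equivFin ι).symm
  have hspan' : ∀ q ≥ 2, ∀ X : ∀ k, Matrix (Fin (D (E k))) (Fin (D (E k))) ℂ,
      (∀ i j, ∑ k, (X k * (T (E k)).block q i j).trace = 0) → X = 0 := by
    intro q hq X hX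
    obtain ⟨n, rfl⟩ : ∃ n, q = n + 1 := ⟨q - 1, by omega⟩
    obtain ⟨X', rfl⟩ := (E.piCongrLeft fun k => Matrix (Fin (D k)) (Fin (D k)) ℂ).symm.surjective X
    have h0 := hspan n (by omega) X' fun i j => by rw [← E.sum_comp]; exact hX i j
    funext k
    exact congrFun h0 (E k)
  have hUT' : ∀ n, ∑ k, (T (E k)).closedMPO (c (E k) • 1) (n + 1) = U n := by
    intro n
    rw [hUT, ← E.sum_comp]
    refine Finset.sum_congr rfl fun k _ => ?_
    ext i j
    simp [closedMPO]
  have hclosed := fun n =>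
    (closedMPO_directSum (fun k => T (E k)) (fun k => c (E k) • 1) (n + 1)).trans (hUT' n)
  have hopen := fun n =>
    (openMPO_openTensor (fun k => T (E k)) (fun k => c (E k) • 1) (n + 1)).trans (hUT' n)
  refine ⟨Fintype.card ι, fun k => D (E k), fun k => T (E k), fun k => c (E k) • 1, hclosed, ?_,
    fun k => hT _, independent_of_span _ (fun k => hD _) 2 hspan', fun k => ?_, hopen, ?_,
    fun q hq => rankCondition_block_openTensor _ (fun k => hc _) (hspan' q hq)⟩
  · rintro (_ | n) hn
    · omega
    · exact hclosed n ▸ hU n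
  · exact (Units.mk0 (c (E k)) (hc _) • (1 : (Matrix (Fin (D (E k))) (Fin (D (E k))) ℂ)ˣ)).isUnit
  · rintro (_ | n) hn
    · omega
    · exact hopen n ▸ hU n

end MPOTensor

/-! ### Joint spanning with and without the identity block -/

namespace CStarWeakHopfAlgebra

open MPOTensor

variable {A : Type*} [CStarAlgebra A] [FiniteDimensional ℂ A] [CStarWeakHopfAlgebra A]

variable {d : ℕ} {φ : A →⋆ₐ[ℂ] Matrix (Fin d) (Fin d) ℂ}

theorem mpo_cocentralSum (c : Irr A →₀ ℂ) (n : ℕ) :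
    mpo φ n (cocentralSum c) =
      ∑ a : c.support, c a • ((Quotient.out a.1).tensor φ).closedMPO 1 (n + 1) := by
  rw [← mpoLinear_apply, cocentralSum, map_finsuppSum, Finsupp.sum, ← Finset.sum_coe_sort]
  refine Finset.sum_congr rfl fun a _ => ?_
  rw [map_smul, mpoLinear_apply, ← mpo_cocentral]
  exact congrArg (fun b : Irr A => c a • mpo φ n (cocentral b)) (Quotient.out_eq a.1).symm

theorem mpuOperator_eq_one_add (e u : Irr A →₀ ℂ) (n : ℕ) :
    mpuOperator φ e u n = 1 + mpo φ n (cocentralSum (u - e)) := by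
  rw [mpuOperator, cocentralSum, ← mpoLinear_apply, map_finsuppSum]
  simp_rw [map_smul, mpoLinear_apply]

/-- The functional `f ↦ ∑_a Tr[X_a ψ_a(f)]`. -/
def traceFunctional {s : Finset (Irr A)}
    (X : ∀ a : s, Matrix (Fin (Quotient.out a.1).dim) (Fin (Quotient.out a.1).dim) ℂ) :
    Module.Dual ℂ (Module.Dual ℂ A) :=
  ∑ a : s, Matrix.traceLinearMap _ ℂ ℂ ∘ₗ LinearMap.mulLeft ℂ (X a) ∘ₗ (Quotient.out a.1).rep

theorem traceFunctional_apply {s : Finset (Irr A)}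
    (X : ∀ a : s, Matrix (Fin (Quotient.out a.1).dim) (Fin (Quotient.out a.1).dim) ℂ)
    (f : Module.Dual ℂ A) :
    traceFunctional X f = ∑ a : s, (X a * (Quotient.out a.1).rep f).trace := by
  simp [traceFunctional]

theorem traceFunctional_eq_zero {s : Finset (Irr A)}
    {X : ∀ a : s, Matrix (Fin (Quotient.out a.1).dim) (Fin (Quotient.out a.1).dim) ℂ}
    (h : traceFunctional X = 0) : X = 0 :=
  eq_zero_of_sum_trace_mul_rep X fun f => by rw [← traceFunctional_apply, h, LinearMap.zero_apply]

/-- Words of any positive length are jointly spanning in inequivalent irreducible blocks. -/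
theorem eq_zero_of_sum_trace_block (hφ : Function.Injective φ) {s : Finset (Irr A)}
    {X : ∀ a : s, Matrix (Fin (Quotient.out a.1).dim) (Fin (Quotient.out a.1).dim) ℂ} {n : ℕ}
    (h : ∀ i j, ∑ a : s, (X a * ((Quotient.out a.1).tensor φ).block (n + 1) i j).trace = 0) :
    X = 0 :=
  traceFunctional_eq_zero <| eq_zero_of_coeffWord hφ n fun i j => by
    simpa only [traceFunctional_apply, DualIrrep.block_tensor] using h i j

/-- Words of length at least two in inequivalent irreducible blocks, together with the identity
tensor, are jointly spanning when the identity is not group-like. -/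
theorem eq_zero_of_add_sum_trace_block [Nonempty (Fin d)] (hφ : Function.Injective φ)
    (hΔ : Coalgebra.comul (R := ℂ) (1 : A) ≠ 1 ⊗ₜ 1) {s : Finset (Irr A)} {z : ℂ}
    {X : ∀ a : s, Matrix (Fin (Quotient.out a.1).dim) (Fin (Quotient.out a.1).dim) ℂ} {n : ℕ}
    (hn : 1 ≤ n)
    (h : ∀ i j, z * (1 : Matrix (Fin (n + 1) → Fin d) (Fin (n + 1) → Fin d) ℂ) i j +
      ∑ a : s, (X a * ((Quotient.out a.1).tensor φ).block (n + 1) i j).trace = 0) :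
    z = 0 ∧ X = 0 := by
  have hz : z = 0 := by
    by_contra hz
    obtain ⟨m, rfl⟩ : ∃ m, n = m + 1 := ⟨n - 1, by omega⟩
    -- By reflexivity the trace functional is evaluation at some `x` in `A`, and the relation
    -- becomes `MPO(x) = -z • 1`.
    refine hΔ (comul_one_of_mpo_eq_smul_one hφ (neg_ne_zero.2 hz) (n := m)
      (x := (Module.evalEquiv ℂ A).symm (traceFunctional X)) ?_)
    ext i j
    rw [mpo_apply, Module.apply_evalEquiv_symm_apply, traceFunctional_apply]
    simp only [← DualIrrep.block_tensor]
    rw [eq_neg_of_add_eq_zero_right (h i j), neg_smul, Matrix.neg_apply, Matrix.smul_apply,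
      smul_eq_mul]
  refine ⟨hz, eq_zero_of_sum_trace_block hφ (n := n) fun i j => ?_⟩
  simpa [hz] using h i j

end CStarWeakHopfAlgebra

end

open CStarWeakHopfAlgebra MPOTensor in
theorem mainTheorem5 {A : Type*} [CStarAlgebra A] [FiniteDimensional ℂ A]
    [CStarWeakHopfAlgebra A] (e u : Irr A →₀ ℂ)
    (he : IsCocentralIdentity (cocentralSum e))
    (hu : star (cocentralSum u) * cocentralSum u = cocentralSum e)
    (hu' : cocentralSum u * star (cocentralSum u) = cocentralSum e)
    {d : ℕ} (φ : A →⋆ₐ[ℂ] Matrix (Fin d) (Fin d) ℂ) (hφ : Function.Injective φ) :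
    ∃ (g : ℕ) (D : Fin g → ℕ) (T : ∀ k, MPOTensor (Fin d) (Fin (D k)))
      (b : ∀ k, Matrix (Fin (D k)) (Fin (D k)) ℂ),
      (∀ n : ℕ, (directSum T).closedMPO (Matrix.blockDiagonal' b) (n + 1) = mpuOperator φ e u n) ∧
      (directSum T).IsMPU (Matrix.blockDiagonal' b) ∧
      (∀ k, (T k).IsInjective) ∧
      Independent T ∧
      (∀ k, IsUnit (b k)) ∧
      (∀ n : ℕ, (openTensor T).openMPO (openLeft b) (openRight D) (n + 1) =
        mpuOperator φ e u n) ∧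
      (openTensor T).IsOpenMPU (openLeft b) (openRight D) ∧
      (∀ q : ℕ, 2 ≤ q →
        ((openTensor T).block q).RankCondition (openLeft b) (openRight D)) := by
  have hU := mpuOperator_mem_unitaryGroup φ he hu'
  -- The split is on whether the identity can be absorbed uniformly in `N`; this also places the
  -- degenerate case `d = 0` in the first branch.
  by_cases hcomb : ∃ c : Irr A →₀ ℂ, ∀ n, mpuOperator φ e u n = mpo φ n (cocentralSum c)
  · obtain ⟨c, hc⟩ := hcomb
    exact exists_mpu_of_span (ι := c.support) (fun a => (Quotient.out a.1).dim)
      (fun a => (Quotient.out a.1).tensor φ) (fun a => c a) _ hU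
      (fun n => (hc n).trans (mpo_cocentralSum c n)) (fun a => Finsupp.mem_support_iff.1 a.2)
      (fun a => (Quotient.out a.1).dim_pos) (fun a => (Quotient.out a.1).isInjective_tensor hφ)
      fun n _ X hX => eq_zero_of_sum_trace_block hφ hX
  · have hd : Nonempty (Fin d) := by
      by_contra hd
      rw [not_nonempty_iff] at hd
      exact hcomb ⟨0, fun n => Subsingleton.elim _ _⟩
    have hΔ : Coalgebra.comul (R := ℂ) (1 : A) ≠ 1 ⊗ₜ 1 := fun h =>
      hcomb (exists_mpuOperator_eq_sum_mpo h φ e u)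
    -- `none` indexes the identity block, with coefficient `1`; pairing each tensor with its bond
    -- dimension lets both kinds of block form one family.
    let F : Option (u - e).support → Σ D : ℕ, MPOTensor (Fin d) (Fin D) := fun o =>
      o.elim ⟨1, identityTensor (Fin d)⟩ fun a => ⟨_, (Quotient.out a.1).tensor φ⟩
    refine exists_mpu_of_span (fun o => (F o).1) (fun o => (F o).2)
      (fun o => o.elim 1 fun a => (u - e) a.1) _ hU (fun n => ?_) ?_ ?_ ?_ fun n hn X hX => ?_
    · rw [Fintype.sum_option, mpuOperator_eq_one_add, mpo_cocentralSum]
      exact congrArg (· + _) ((one_smul ℂ _).trans (closedMPO_identityTensor (n + 1))).symm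
    · rintro (_ | a)
      · exact one_ne_zero
      · exact Finsupp.mem_support_iff.1 a.2
    · rintro (_ | a)
      · exact one_pos
      · exact (Quotient.out a.1).dim_pos
    · rintro (_ | a)
      · exact isInjective_identityTensor
      · exact (Quotient.out a.1).isInjective_tensor hφ
    · have h := eq_zero_of_add_sum_trace_block hφ hΔ hn (z := (X none).trace)
        (X := fun a => X (some a)) fun i j => by
          rw [← hX i j, Fintype.sum_option]
          exact congrArg (· + _) (trace_mul_block_identityTensor (X none) (n + 1) i j).symm
      funext o
      rcases o with _ | a
      · exact matrix_fin_one_eq_zero_of_trace h.1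
      · exact congrFun h.2 a
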